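/- **Clustered dictionary model.** Let $c,n,m_1,\dots,m_c$ be nonnegative integers and $m=\sum_j m_j$. Let $U=[u_1,\dots,u_c]\in\mathbb R^{n\times c}$ and $A=[A_1,\dots,A_c]\in\mathbb R^{n\times m}$, with $A_j\in\mathbb R^{n\times m_j}$, be matrices whose columns all have unit $\ell_2$ norm, and let $v_j\in\mathbb R^{m_j}$ for $j=1,\dots,c$. For $\epsilon>0$ let $\Phi=\Phi(\epsilon)=[\,u_1v_1^\top+\epsilon A_1,\ \dots,\ u_cv_c^\top+\epsilon A_c\,]\,N$, where $N$ is the diagonal matrix that normalizes the columns to unit $\ell_2$ norm. For $x\in\mathbb R^m$ let $\mathcal S_c(x)\subseteq\{1,\dots,c\}$ be the set of clusters (blocks) in which $x$ has at least one nonzero entry. For $\mathcal J\subseteq\{1,\dots,c\}$ let $A(\mathcal J)=[A_j : j\in\mathcal J]$. The restricted isometry constant $\delta_k[M]$ of a matrix $M$ is the smallest $\delta\ge 0$ with $(1-\delta)\|x\|_2^2\le\|Mx\|_2^2\le(1+\delta)\|x\|_2^2$ for all $x$ with $\|x\|_0\le k$. **Adaptive IHT (A-IHT).** An A-IHT scheme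 on $\mathbb R^{d}$ consists of prescribed sequences of weights $\Psi^{(t)}\in\mathbb R^{d\times d}$, $\Gamma^{(t)}\in\mathbb R^{d\times n}$ and sparsity levels $k^{(t)}$, and of a prescribed schedule that computes two support sets $\Omega_{\rm on}^{(t)},\Omega_{\rm off}^{(t)}\subseteq\{1,\dots,d\}$ from the activations $x^{(t)}$ by linear filters followed by indicator functions (coordinate $i$ belongs to the set if and only if the $i$-th entry of a prescribed linear function of $x^{(t)}$ lies in a prescribed subset of $\mathbb R$). On input $y\in\mathbb R^n$ it performs the iterations $x^{(0)}=0$, $x^{(t+1)}=H_{k^{(t)}}\big[\Psi^{(t)}x^{(t)}+\Gamma^{(t)}y;\ \Omega_{\rm on}^{(t)},\Omega_{\rm off}^{(t)}\big]$, where $H_k[\chi;\Omega_{\rm on},\Omega_{\rm off}]$ sets the entries of $\chi$ in $\Omega_{\rm off}$ to zero, keeps the other entries in $\Omega_{\rm on}$, and of the remaining entries keeps the $k$ largest in magnitude (all of them if there are fewer than $k$; ties broken arbitrarily) and sets the others to zero. **Proposition.** Let $k_x,k_c$ be nonnegative integers, and suppose that $$\delta_{3k_x+k_c}\big([U,A(\mathcal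 J)]\big)<1/\sqrt{32}\qquad\text{for every }\mathcal J\subseteq\{1,\dots,c\}.$$ Then there are an integer $p\ge 0$, an A-IHT scheme on $\mathbb R^{m+p}$ (the first $m$ coordinates correspond to the columns of $\Phi$, the other $p$ are auxiliary) and an $\epsilon'>0$ such that for every $\epsilon\in(0,\epsilon']$ and every $x^*\in\mathbb R^m$ with $\|x^*\|_0\le k_x$ and $|\mathcal S_c(x^*)|\le k_c$ the scheme, run on $y=\Phi(\epsilon)x^*$, recovers the support of $x^*$ in finitely many iterations: there is a $T$ such that, for all $t\ge T$ and $i=1,\dots,m$, $x^{(t)}_i\neq 0$ if and only if $x^*_i\ne0$. -/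

import Mathlib

open scoped Matrix

noncomputable section

/-- The Euclidean norm of a finite real vector. -/
def euclNorm {ι : Type*} [Fintype ι] (x : ι → ℝ) : ℝ :=
  ‖(WithLp.toLp 2 x : EuclideanSpace ℝ ι)‖

/-- The number of nonzero coordinates of `x`. -/
def l0 {ι : Type*} (x : ι → ℝ) : ℕ := (Function.support x).ncard

/-- The restricted isometry inequalities of order `k` with constant `δ`. -/
def SatisfiesRIP {n ι : Type*} [Fintype n] [Fintype ι]
    (M : Matrix n ι ℝ) (k : ℕ) (δ : ℝ) : Prop :=
  ∀ x : ι → ℝ, l0 x ≤ k →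
    (1 - δ) * euclNorm x ^ 2 ≤ euclNorm (M *ᵥ x) ^ 2 ∧
      euclNorm (M *ᵥ x) ^ 2 ≤ (1 + δ) * euclNorm x ^ 2

/-- The restricted isometry constant `δ_k[M]`: the smallest nonnegative constant for which the
restricted isometry inequalities of order `k` hold. -/
def ripConst {n ι : Type*} [Fintype n] [Fintype ι] (M : Matrix n ι ℝ) (k : ℕ) : ℝ :=
  sInf {δ : ℝ | 0 ≤ δ ∧ SatisfiesRIP M k δ}

/-- Column indices of a matrix partitioned into `c` blocks, the `j`-th one having `m j` columns. -/
abbrev Cols {c : ℕ} (m : Fin c → ℕ) : Type := Σ j : Fin c, Fin (m j)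

/-- Every column of `M` has unit Euclidean norm. -/
def UnitColumns {n ι : Type*} [Fintype n] (M : Matrix n ι ℝ) : Prop :=
  ∀ p : ι, euclNorm (fun i => M i p) = 1

/-- `[U, A(J)]`: the columns of `U` followed by those blocks of `A` with index in `J`. -/
def concatBlocks {n c : ℕ} {m : Fin c → ℕ} (U : Matrix (Fin n) (Fin c) ℝ)
    (A : Matrix (Fin n) (Cols m) ℝ) (J : Finset (Fin c)) :
    Matrix (Fin n) (Fin c ⊕ {p : Cols m // p.1 ∈ J}) ℝ :=
  Matrix.fromCols U (A.submatrix id Subtype.val)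

/-- The unnormalized dictionary whose `j`-th block is `u_j v_jᵀ + ε A_j`. -/
def rawDictionary {n c : ℕ} {m : Fin c → ℕ} (U : Matrix (Fin n) (Fin c) ℝ)
    (A : Matrix (Fin n) (Cols m) ℝ) (v : (j : Fin c) → Fin (m j) → ℝ) (ε : ℝ) :
    Matrix (Fin n) (Cols m) ℝ :=
  Matrix.of fun i p => U i p.1 * v p.1 p.2 + ε * A i p

/-- The dictionary `Φ = [Φ_1, …, Φ_c] N` of the clustered dictionary model, where `N` is the
diagonal matrix that normalizes the columns. -/
def clusteredDictionary {n c : ℕ} {m : Fin c → ℕ} (U : Matrix (Fin n) (Fin c) ℝ)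
    (A : Matrix (Fin n) (Cols m) ℝ) (v : (j : Fin c) → Fin (m j) → ℝ) (ε : ℝ) :
    Matrix (Fin n) (Cols m) ℝ :=
  rawDictionary U A v ε *
    Matrix.diagonal fun p => (euclNorm fun i => rawDictionary U A v ε i p)⁻¹

/-- The clusters in which `x` has at least one nonzero coordinate. -/
def clusterSupport {c : ℕ} {m : Fin c → ℕ} (x : Cols m → ℝ) : Set (Fin c) :=
  {j | ∃ l : Fin (m j), x ⟨j, l⟩ ≠ 0}

/-- `x` is a value of `H_k[χ; on, off]`: coordinates in `off` are set to zero, the other coordinates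
in `on` are kept, and among the remaining ones the `k` of largest magnitude (all of them, if there
are fewer than `k`) are kept, the others being set to zero. Ties are broken in any way. -/
def IsGatedHardThreshold {ι : Type*} (k : ℕ) (on off : Set ι) (χ x : ι → ℝ) : Prop :=
  ∃ K : Set ι, K ⊆ (on ∪ off)ᶜ ∧ K.ncard = min k ((on ∪ off)ᶜ).ncard ∧
    (∀ i ∈ K, ∀ j ∈ (on ∪ off)ᶜ \ K, |χ j| ≤ |χ i|) ∧
    x = ((on ∪ K) \ off).indicator χ

/-- An adaptive iterative hard-thresholding scheme for observations in `ℝⁿ`, acting on vectors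
indexed by `ι`: prescribed sequences of weights `Ψ⁽ᵗ⁾`, `Γ⁽ᵗ⁾` and of sparsity levels `k⁽ᵗ⁾`, and a
prescribed schedule for computing the two support sets from the activations of the prior layer, by
linear filters followed by indicator functions. -/
structure AIHT (n : ℕ) (ι : Type*) where
  Ψ : ℕ → Matrix ι ι ℝ
  Γ : ℕ → Matrix ι (Fin n) ℝ
  k : ℕ → ℕ
  /-- linear filters of the on-gates -/
  onFilter : ℕ → Matrix ι ι ℝ
  /-- values of the filter at which a unit is put in the on-set -/
  onValues : ℕ → ι → Set ℝ
  /-- linear filters of the off-gates -/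
  offFilter : ℕ → Matrix ι ι ℝ
  /-- values of the filter at which a unit is put in the off-set -/
  offValues : ℕ → ι → Set ℝ

namespace AIHT

variable {n : ℕ} {ι : Type*} [Fintype ι]

/-- The support set `Ω_on⁽ᵗ⁾`, as a function of the activations `x⁽ᵗ⁾`. -/
def onSet (S : AIHT n ι) (t : ℕ) (x : ι → ℝ) : Set ι :=
  {i | (S.onFilter t *ᵥ x) i ∈ S.onValues t i}

/-- The support set `Ω_off⁽ᵗ⁾`, as a function of the activations `x⁽ᵗ⁾`. -/
def offSet (S : AIHT n ι) (t : ℕ) (x : ι → ℝ) : Set ι :=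
  {i | (S.offFilter t *ᵥ x) i ∈ S.offValues t i}

/-- `x⁽⁰⁾, x⁽¹⁾, …` is a run of the scheme on the observation `y`:
`x⁽⁰⁾ = 0` and `x⁽ᵗ⁺¹⁾ = H_{k⁽ᵗ⁾}[Ψ⁽ᵗ⁾ x⁽ᵗ⁾ + Γ⁽ᵗ⁾ y; Ω_on⁽ᵗ⁾, Ω_off⁽ᵗ⁾]`. -/
def IsRun (S : AIHT n ι) (y : Fin n → ℝ) (x : ℕ → ι → ℝ) : Prop :=
  x 0 = 0 ∧ ∀ t, IsGatedHardThreshold (S.k t) (S.onSet t (x t)) (S.offSet t (x t))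
    (S.Ψ t *ᵥ x t + S.Γ t *ᵥ y) (x (t + 1))

end AIHT

/-- Hard thresholding always has a value. -/
theorem exists_isGatedHardThreshold {ι : Type*} [Finite ι] (k : ℕ) (on off : Set ι) (χ : ι → ℝ) :
    ∃ x, IsGatedHardThreshold k on off χ x := by
  suffices h : ∀ (F : Set ι) (r : ℕ), r ≤ F.ncard →
      ∃ K ⊆ F, K.ncard = r ∧ ∀ i ∈ K, ∀ j ∈ F \ K, |χ j| ≤ |χ i| by
    obtain ⟨K, h1, h2, h3⟩ := h (on ∪ off)ᶜ (min k ((on ∪ off)ᶜ).ncard) (min_le_right _ _)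
    exact ⟨_, K, h1, h2, h3, rfl⟩
  intro F r
  induction r with
  | zero => intro _; exact ⟨∅, by simp, by simp, by simp⟩
  | succ r ih =>
    intro hr
    obtain ⟨K, h1, h2, h3⟩ := ih (by omega)
    have hne : (F \ K).Nonempty := by
      rw [Set.nonempty_iff_ne_empty]
      intro he
      have := Set.ncard_le_ncard (Set.sdiff_eq_empty.1 he) (Set.toFinite K)
      omega
    obtain ⟨a, ha, hmax⟩ := Set.exists_max_image (F \ K) (fun i => |χ i|) (Set.toFinite _) hne
    refine ⟨insert a K, Set.insert_subset ha.1 h1, ?_, ?_⟩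
    · rw [Set.ncard_insert_of_notMem ha.2 (Set.toFinite K), h2]
    · intro i hi j hj
      have hj' : j ∈ F \ K := ⟨hj.1, fun h => hj.2 (Set.mem_insert_of_mem _ h)⟩
      rcases hi with rfl | hi
      · exact hmax j hj'
      · exact h3 i hi j hj'

/-- Every scheme has a run on every observation. -/
theorem AIHT.exists_isRun {n : ℕ} {ι : Type*} [Fintype ι] (S : AIHT n ι) (y : Fin n → ℝ) :
    ∃ x, S.IsRun y x := by
  choose f hf using fun (t : ℕ) (x : ι → ℝ) => exists_isGatedHardThreshold (S.k t)
    (S.onSet t x) (S.offSet t x) (S.Ψ t *ᵥ x + S.Γ t *ᵥ y)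
  exact ⟨fun t => Nat.rec 0 (fun t x => f t x) t, rfl, fun t => hf t _⟩

end

/-! The clustered dictionary is coherent, but its signals are sparse over the well-conditioned
matrix `[U, A]`. Indeed `Φ(ε) x = [U, A] z`, where `z` holds one weighted sum per cluster and the
entries of `x` scaled by `ε` and the normalization (`concatBlocks_mulVec_liftedCoeffs`). With `k =
kx + min kx kc`, `z` is `k`-sparse, and `2k ≤ 3kx + kc`, so the hypothesis with all blocks gives
restricted isometry of order `2k`. Auxiliary units run ordinary hard thresholding for `[U, A]`; its
squared residual at least halves at each step (`residual_le_geometric`). Readout units compare the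
`A`-part of the iterate with `(3/4)^t`: this decays more slowly than the error, of order
`(1/2)^(t/2)`, yet tends to zero, so it eventually separates zero from nonzero entries without
knowledge of `x` or `ε`. -/

open Matrix Filter Topology

/-! ### Norms, sparsity and restricted isometry -/

theorem euclNorm_sq {ι : Type*} [Fintype ι] (x : ι → ℝ) : euclNorm x ^ 2 = x ⬝ᵥ x := by
  simp [euclNorm, EuclideanSpace.norm_sq_eq, dotProduct, ← sq]

theorem euclNorm_smul {ι : Type*} [Fintype ι] (a : ℝ) (x : ι → ℝ) :
    euclNorm (a • x) = |a| * euclNorm x := by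
  rw [euclNorm, WithLp.toLp_smul, norm_smul, Real.norm_eq_abs, euclNorm]

theorem sq_apply_le_dotProduct_self {ι : Type*} [Fintype ι] (x : ι → ℝ) (i : ι) :
    x i ^ 2 ≤ x ⬝ᵥ x := by
  rw [dotProduct, sq]
  exact Finset.single_le_sum (f := fun i => x i * x i) (fun j _ => mul_self_nonneg _)
    (Finset.mem_univ i)

theorem l0_sub_le {ι : Type*} [Finite ι] (x y : ι → ℝ) : l0 (x - y) ≤ l0 x + l0 y :=
  (Set.ncard_le_ncard (Function.support_sub x y) (Set.toFinite _)).trans (Set.ncard_union_le _ _)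

/-- The restricted isometry inequalities hold for some constant. -/
theorem exists_satisfiesRIP {n ι : Type*} [Fintype n] [Fintype ι] (M : Matrix n ι ℝ) (k : ℕ) :
    ∃ δ, 0 ≤ δ ∧ SatisfiesRIP M k δ := by
  classical
  set L := (Matrix.toLpLin 2 2 M).toContinuousLinearMap with hL
  have hx : ∀ x : ι → ℝ, euclNorm (M *ᵥ x) ≤ ‖L‖ * euclNorm x := fun x =>
    L.le_opNorm (WithLp.toLp 2 x)
  -- The summand `1` makes `1 - δ` nonpositive, so the lower inequality is trivial.
  refine ⟨‖L‖ ^ 2 + 1, by positivity, fun x _ => ⟨?_, ?_⟩⟩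
  · nlinarith [sq_nonneg (euclNorm (M *ᵥ x)), mul_nonneg (sq_nonneg ‖L‖) (sq_nonneg (euclNorm x))]
  · have h := pow_le_pow_left₀ (norm_nonneg _) (hx x) 2
    rw [mul_pow] at h
    refine h.trans (mul_le_mul_of_nonneg_right (by linarith) (sq_nonneg _))

theorem exists_satisfiesRIP_of_ripConst_lt {n ι : Type*} [Fintype n] [Fintype ι]
    {M : Matrix n ι ℝ} {k : ℕ} {a : ℝ} (h : ripConst M k < a) :
    ∃ δ, 0 ≤ δ ∧ δ < a ∧ SatisfiesRIP M k δ := by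
  obtain ⟨δ, hδ, hlt⟩ := exists_lt_of_csInf_lt (exists_satisfiesRIP M k) h
  exact ⟨δ, hδ.1, hlt, hδ.2⟩

theorem SatisfiesRIP.mono {n ι : Type*} [Fintype n] [Fintype ι] {M : Matrix n ι ℝ} {k l : ℕ}
    {δ : ℝ} (h : SatisfiesRIP M k δ) (hl : l ≤ k) : SatisfiesRIP M l δ :=
  fun x hx => h x (hx.trans hl)

theorem l0_comp_equiv {ι κ : Type*} (e : κ ≃ ι) (x : ι → ℝ) : l0 (x ∘ e) = l0 x := by
  unfold l0
  rw [Function.support_comp_eq_preimage]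
  exact Set.ncard_preimage_of_injective_subset_range e.injective (by simp)

theorem euclNorm_comp_equiv {ι κ : Type*} [Fintype ι] [Fintype κ] (e : κ ≃ ι) (x : ι → ℝ) :
    euclNorm (x ∘ e) = euclNorm x := by
  simp only [euclNorm, EuclideanSpace.norm_eq]
  exact congrArg _ (e.sum_comp fun i => ‖x i‖ ^ 2)

theorem SatisfiesRIP.submatrix {n ι κ : Type*} [Fintype n] [Fintype ι] [Fintype κ]
    {M : Matrix n ι ℝ} {k : ℕ} {δ : ℝ} (h : SatisfiesRIP M k δ) (e : κ ≃ ι) :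
    SatisfiesRIP (M.submatrix id e) k δ := by
  intro x hx
  have h' := h (x ∘ e.symm) (by rwa [l0_comp_equiv])
  rwa [euclNorm_comp_equiv, ← Function.comp_id (M *ᵥ (x ∘ e.symm)),
    ← Matrix.submatrix_mulVec_equiv] at h'

/-! ### Convergence of iterative hard thresholding -/

/-- Keeping the `k` entries of largest magnitude gives a best `k`-sparse approximation. -/
theorem dotProduct_indicator_sub_le {ι : Type*} [Fintype ι] {k : ℕ} {χ w : ι → ℝ} {K : Set ι}
    (hK : K.ncard = min k (Fintype.card ι)) (hmax : ∀ i ∈ K, ∀ j ∉ K, |χ j| ≤ |χ i|)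
    (hw : l0 w ≤ k) :
    (K.indicator χ - χ) ⬝ᵥ (K.indicator χ - χ) ≤ (w - χ) ⬝ᵥ (w - χ) := by
  classical
  set F := K.toFinset
  set W := (Function.support w).toFinset
  have hFK : F.card = K.ncard := (Set.ncard_eq_toFinset_card' K).symm
  have hWF : W.card ≤ F.card := by
    rw [hFK, hK, le_min_iff]
    exact ⟨(Set.ncard_eq_toFinset_card' _).symm.trans_le hw, Finset.card_le_univ _⟩
  -- Exchange argument: `W \ F` is no larger than `F \ W`, and every entry of `χ` on it is dominated
  -- by every entry on `F \ W`.
  have hsd : (W \ F).card ≤ (F \ W).card := by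
    have h1 := Finset.card_sdiff_add_card_inter W F
    have h2 := Finset.card_sdiff_add_card_inter F W
    rw [Finset.inter_comm] at h2
    omega
  have hsum : ∑ i ∈ W \ F, χ i ^ 2 ≤ ∑ i ∈ F \ W, χ i ^ 2 := by
    rcases (W \ F).eq_empty_or_nonempty with he | hne
    · rw [he, Finset.sum_empty]
      exact Finset.sum_nonneg fun _ _ => sq_nonneg _
    · obtain ⟨a, ha, hamax⟩ := Finset.exists_max_image (W \ F) (fun i => χ i ^ 2) hne
      calc ∑ i ∈ W \ F, χ i ^ 2 ≤ (W \ F).card • χ a ^ 2 := Finset.sum_le_card_nsmul _ _ _ hamax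
        _ ≤ (F \ W).card • χ a ^ 2 := nsmul_le_nsmul_left (sq_nonneg _) hsd
        _ ≤ ∑ i ∈ F \ W, χ i ^ 2 := by
          refine Finset.card_nsmul_le_sum _ _ _ fun i hi => sq_le_sq.2 (hmax i ?_ a ?_)
          · exact Set.mem_toFinset.1 (Finset.mem_sdiff.1 hi).1
          · exact fun h => (Finset.mem_sdiff.1 ha).2 (Set.mem_toFinset.2 h)
  have hle : ∑ i ∈ W, χ i ^ 2 ≤ ∑ i ∈ F, χ i ^ 2 := by
    rw [← Finset.sum_inter_add_sum_sdiff W F, ← Finset.sum_inter_add_sum_sdiff F W,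
      Finset.inter_comm]
    linarith
  have hF : (K.indicator χ - χ) ⬝ᵥ (K.indicator χ - χ) = ∑ i ∈ Fᶜ, χ i ^ 2 := by
    rw [dotProduct, ← Finset.sum_add_sum_compl F, Finset.sum_eq_zero, zero_add]
    · refine Finset.sum_congr rfl fun i hi => ?_
      have : i ∉ K := fun h => Finset.mem_compl.1 hi (Set.mem_toFinset.2 h)
      simp [this, sq]
    · intro i hi
      simp [Set.mem_toFinset.1 hi]
  have hW : ∑ i ∈ Wᶜ, χ i ^ 2 ≤ (w - χ) ⬝ᵥ (w - χ) := by
    rw [dotProduct, ← Finset.sum_add_sum_compl W]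
    refine (Finset.sum_le_sum fun i hi => ?_).trans
      (le_add_of_nonneg_left (Finset.sum_nonneg fun i _ => mul_self_nonneg _))
    have : w i = 0 := by simpa [W] using hi
    simp [this, sq]
  have h1 := Finset.sum_add_sum_compl F fun i => χ i ^ 2
  have h2 := Finset.sum_add_sum_compl W fun i => χ i ^ 2
  linarith

/-- A step of iterative hard thresholding with step size `1 / (1 + δ)` decreases the squared
residual by the factor `2δ / (1 - δ)`. -/
theorem residual_le_of_hardThreshold {n ι : Type*} [Fintype n] [Fintype ι] {D : Matrix n ι ℝ}
    {k : ℕ} {δ : ℝ} (hδ : 0 ≤ δ) (hδ1 : δ < 1) (hD : SatisfiesRIP D (2 * k) δ)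
    {xs x x' : ι → ℝ} (hxs : l0 xs ≤ k) (hx : l0 x ≤ k) (hx' : l0 x' ≤ k)
    (hopt : (x' - (x + (1 + δ)⁻¹ • Dᵀ *ᵥ (D *ᵥ (xs - x)))) ⬝ᵥ
        (x' - (x + (1 + δ)⁻¹ • Dᵀ *ᵥ (D *ᵥ (xs - x)))) ≤
      (xs - (x + (1 + δ)⁻¹ • Dᵀ *ᵥ (D *ᵥ (xs - x)))) ⬝ᵥ
        (xs - (x + (1 + δ)⁻¹ • Dᵀ *ᵥ (D *ᵥ (xs - x))))) :
    (D *ᵥ (xs - x')) ⬝ᵥ (D *ᵥ (xs - x')) ≤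
      2 * δ / (1 - δ) * ((D *ᵥ (xs - x)) ⬝ᵥ (D *ᵥ (xs - x))) := by
  obtain ⟨g, hg⟩ : ∃ g, g = xs - x := ⟨_, rfl⟩
  obtain ⟨h, hh⟩ : ∃ h, h = x' - x := ⟨_, rfl⟩
  have hRg := hD g (by rw [hg]; exact (l0_sub_le _ _).trans (by omega))
  have hRh := hD h (by rw [hh]; exact (l0_sub_le _ _).trans (by omega))
  simp only [euclNorm_sq] at hRg hRh
  rw [← hg] at hopt ⊢
  have e1 : xs - x' = g - h := by rw [hg, hh]; abel
  obtain ⟨q, hq⟩ : ∃ q, q = Dᵀ *ᵥ (D *ᵥ g) := ⟨_, rfl⟩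
  have hadj : ∀ a : ι → ℝ, a ⬝ᵥ q = (D *ᵥ a) ⬝ᵥ (D *ᵥ g) := fun a => by
    rw [hq, Matrix.dotProduct_mulVec, Matrix.vecMul_transpose]
  have e2 : x' - (x + (1 + δ)⁻¹ • q) = h - (1 + δ)⁻¹ • q := by rw [hh]; abel
  have e3 : xs - (x + (1 + δ)⁻¹ • q) = g - (1 + δ)⁻¹ • q := by rw [hg]; abel
  have hexp : ∀ a : ι → ℝ, (a - (1 + δ)⁻¹ • q) ⬝ᵥ (a - (1 + δ)⁻¹ • q) =
      a ⬝ᵥ a - 2 * (1 + δ)⁻¹ * ((D *ᵥ a) ⬝ᵥ (D *ᵥ g)) + (1 + δ)⁻¹ ^ 2 * (q ⬝ᵥ q) := fun a => by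
    rw [← hadj]
    simp only [sub_dotProduct, dotProduct_sub, smul_dotProduct, dotProduct_smul, smul_eq_mul,
      dotProduct_comm q a]
    ring
  rw [← hq, e2, e3, hexp, hexp] at hopt
  rw [e1, Matrix.mulVec_sub]
  simp only [sub_dotProduct, dotProduct_sub, dotProduct_comm (D *ᵥ g) (D *ᵥ h)]
  set G := (D *ᵥ g) ⬝ᵥ (D *ᵥ g)
  set X := (D *ᵥ h) ⬝ᵥ (D *ᵥ g)
  set H := (D *ᵥ h) ⬝ᵥ (D *ᵥ h)
  have hpos : 0 < 1 + δ := by linarith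
  -- Optimality of `x'`, rescaled: `h` does at least as well as `g` in the surrogate `(1 + δ)‖h‖² -
  -- 2⟨Dh, Dg⟩`, which majorizes `‖Dh‖² - 2⟨Dh, Dg⟩` by restricted isometry.
  have hopt' : (1 + δ) * (h ⬝ᵥ h) - 2 * X ≤ (1 + δ) * (g ⬝ᵥ g) - 2 * G := by
    have := mul_le_mul_of_nonneg_left hopt hpos.le
    have hi : (1 + δ) * (1 + δ)⁻¹ = 1 := mul_inv_cancel₀ hpos.ne'
    linear_combination this + 2 * (X - G) * hi
  have hgg : g ⬝ᵥ g ≤ G / (1 - δ) := by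
    rw [le_div_iff₀ (by linarith)]; linarith [hRg.1]
  have hfin : 2 * δ / (1 - δ) * G = (1 + δ) * (G / (1 - δ)) - G := by
    field_simp [show (1 - δ) ≠ 0 by linarith]
    ring
  rw [hfin]
  nlinarith [hRh.2]

theorem l0_indicator_le {ι : Type*} [Finite ι] (K : Set ι) (χ : ι → ℝ) :
    l0 (K.indicator χ) ≤ K.ncard :=
  Set.ncard_le_ncard Set.support_indicator_subset (Set.toFinite K)

/-- Linear convergence of iterative hard thresholding. -/
theorem residual_le_geometric {n ι : Type*} [Fintype n] [Fintype ι] {D : Matrix n ι ℝ}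
    {k : ℕ} {δ : ℝ} (hδ : 0 ≤ δ) (hδ1 : δ ≤ 1 / 5) (hD : SatisfiesRIP D (2 * k) δ)
    {xs : ι → ℝ} (hxs : l0 xs ≤ k) {x : ℕ → ι → ℝ} (hx0 : x 0 = 0) (K : ℕ → Set ι)
    (hK : ∀ t, (K t).ncard = min k (Fintype.card ι))
    (hmax : ∀ t, ∀ i ∈ K t, ∀ j ∉ K t,
      |(x t + (1 + δ)⁻¹ • Dᵀ *ᵥ (D *ᵥ (xs - x t))) j| ≤
        |(x t + (1 + δ)⁻¹ • Dᵀ *ᵥ (D *ᵥ (xs - x t))) i|)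
    (hx : ∀ t, x (t + 1) =
      (K t).indicator (x t + (1 + δ)⁻¹ • Dᵀ *ᵥ (D *ᵥ (xs - x t)))) (t : ℕ) :
    l0 (x t) ≤ k ∧ (D *ᵥ (xs - x t)) ⬝ᵥ (D *ᵥ (xs - x t)) ≤
      (1 / 2) ^ t * ((D *ᵥ xs) ⬝ᵥ (D *ᵥ xs)) := by
  induction t with
  | zero => simp [hx0, l0]
  | succ t ih =>
    have hs : l0 (x (t + 1)) ≤ k := by
      rw [hx t]
      exact (l0_indicator_le _ _).trans ((hK t).trans_le (min_le_left _ _))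
    refine ⟨hs, ?_⟩
    have hopt := dotProduct_indicator_sub_le (hK t) (hmax t) hxs
    rw [← hx t] at hopt
    have hstep := residual_le_of_hardThreshold hδ (by linarith) hD hxs ih.1 hs hopt
    have hrate : 2 * δ / (1 - δ) ≤ 1 / 2 := by
      rw [div_le_iff₀ (by linarith)]; linarith
    have hnn : 0 ≤ (D *ᵥ (xs - x t)) ⬝ᵥ (D *ᵥ (xs - x t)) := by
      rw [← euclNorm_sq]; positivity
    calc _ ≤ 1 / 2 * ((D *ᵥ (xs - x t)) ⬝ᵥ (D *ᵥ (xs - x t))) :=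
          hstep.trans (mul_le_mul_of_nonneg_right hrate hnn)
      _ ≤ 1 / 2 * ((1 / 2) ^ t * ((D *ᵥ xs) ⬝ᵥ (D *ᵥ xs))) := by linarith [ih.2]
      _ = _ := by ring

/-! ### The scheme with a thresholded readout layer -/

/-- Iterative hard thresholding for `D` on the units `κ`, with a readout layer `ι`: the readout
unit `i` copies the unit `f i` if the magnitude of the latter exceeds `(3/4)ᵗ`, and is set to
zero otherwise. -/
noncomputable def thresholdedReadoutIHT {n : ℕ} {ι κ : Type*} [Fintype κ] [DecidableEq κ]
    (D : Matrix (Fin n) κ ℝ) (f : ι → κ) (k : ℕ) (μ : ℝ) : AIHT n (ι ⊕ κ) where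
  Ψ _ := Matrix.fromBlocks 0 ((1 : Matrix κ κ ℝ).submatrix f id) 0 (1 - μ • (Dᵀ * D))
  Γ _ := Matrix.fromRows 0 (μ • Dᵀ)
  k _ := k
  onFilter _ := Matrix.fromBlocks 0 ((1 : Matrix κ κ ℝ).submatrix f id) 0 0
  onValues t := Sum.elim (fun _ => {a | (3 / 4) ^ t < |a|}) fun _ => ∅
  offFilter _ := Matrix.fromBlocks 0 ((1 : Matrix κ κ ℝ).submatrix f id) 0 0
  offValues t := Sum.elim (fun _ => {a | |a| ≤ (3 / 4) ^ t}) fun _ => ∅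

theorem one_submatrix_mulVec {ι κ : Type*} [Fintype κ] [DecidableEq κ] (f : ι → κ)
    (z : κ → ℝ) :
    (1 : Matrix κ κ ℝ).submatrix f id *ᵥ z = z ∘ f := by
  ext i
  simp [Matrix.mulVec, dotProduct, Matrix.one_apply]

section Readout

variable {n : ℕ} {ι κ : Type*} [Fintype ι] [Fintype κ] [DecidableEq κ]
  {D : Matrix (Fin n) κ ℝ} {f : ι → κ} {k : ℕ} {μ : ℝ}

theorem onSet_thresholdedReadoutIHT (t : ℕ) (x : ι ⊕ κ → ℝ) :
    (thresholdedReadoutIHT D f k μ).onSet t x =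
      Sum.inl '' {i | (3 / 4) ^ t < |x (Sum.inr (f i))|} := by
  ext (i | i) <;>
    simp [AIHT.onSet, thresholdedReadoutIHT, Matrix.fromBlocks_mulVec, one_submatrix_mulVec]

theorem offSet_thresholdedReadoutIHT (t : ℕ) (x : ι ⊕ κ → ℝ) :
    (thresholdedReadoutIHT D f k μ).offSet t x =
      Sum.inl '' {i | |x (Sum.inr (f i))| ≤ (3 / 4) ^ t} := by
  ext (i | i) <;>
    simp [AIHT.offSet, thresholdedReadoutIHT, Matrix.fromBlocks_mulVec, one_submatrix_mulVec]

theorem thresholdedReadoutIHT_activation (t : ℕ) (x : ι ⊕ κ → ℝ) (y : Fin n → ℝ) :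
    (thresholdedReadoutIHT D f k μ).Ψ t *ᵥ x + (thresholdedReadoutIHT D f k μ).Γ t *ᵥ y =
      Sum.elim (x ∘ Sum.inr ∘ f)
        (x ∘ Sum.inr + μ • Dᵀ *ᵥ (y - D *ᵥ (x ∘ Sum.inr))) := by
  ext (i | i)
  · simp [thresholdedReadoutIHT, Matrix.fromBlocks_mulVec, one_submatrix_mulVec,
      Matrix.fromRows_mulVec]
  · simp [thresholdedReadoutIHT, Matrix.fromBlocks_mulVec, Matrix.fromRows_mulVec,
      Matrix.sub_mulVec, Matrix.smul_mulVec, Matrix.mulVec_sub, mul_sub]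
    ring

/-- The readout of a step. -/
theorem thresholdedReadoutIHT_readout {y : Fin n → ℝ} {x : ℕ → ι ⊕ κ → ℝ}
    (hrun : (thresholdedReadoutIHT D f k μ).IsRun y x) (t : ℕ) (i : ι) :
    x (t + 1) (Sum.inl i) ≠ 0 ↔ (3 / 4) ^ t < |x t (Sum.inr (f i))| := by
  obtain ⟨K, hK, -, -, hx⟩ := hrun.2 t
  rw [thresholdedReadoutIHT_activation, onSet_thresholdedReadoutIHT,
    offSet_thresholdedReadoutIHT] at hx
  have hpow : (0 : ℝ) < (3 / 4) ^ t := by positivity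
  rw [hx]
  by_cases h : (3 / 4) ^ t < |x t (Sum.inr (f i))|
  · have : x t (Sum.inr (f i)) ≠ 0 := abs_pos.1 (hpow.trans h)
    simp [Set.indicator, h, this]
  · simp [Set.indicator, h, not_lt.1 h]

/-- The units `κ` perform iterative hard thresholding. -/
theorem thresholdedReadoutIHT_iterate {y : Fin n → ℝ} {x : ℕ → ι ⊕ κ → ℝ}
    (hrun : (thresholdedReadoutIHT D f k μ).IsRun y x) (t : ℕ) :
    ∃ K : Set κ, K.ncard = min k (Fintype.card κ) ∧
      (∀ i ∈ K, ∀ j ∉ K,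
        |(x t ∘ Sum.inr + μ • Dᵀ *ᵥ (y - D *ᵥ (x t ∘ Sum.inr))) j| ≤
          |(x t ∘ Sum.inr + μ • Dᵀ *ᵥ (y - D *ᵥ (x t ∘ Sum.inr))) i|) ∧
      x (t + 1) ∘ Sum.inr =
        K.indicator (x t ∘ Sum.inr + μ • Dᵀ *ᵥ (y - D *ᵥ (x t ∘ Sum.inr))) := by
  obtain ⟨K, hK, hcard, hmax, hx⟩ := hrun.2 t
  rw [thresholdedReadoutIHT_activation] at hmax hx
  -- Each readout unit is gated either on or off, so only the units `κ` compete for the `k` places.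
  have hfree : ((thresholdedReadoutIHT D f k μ).onSet t (x t) ∪
      (thresholdedReadoutIHT D f k μ).offSet t (x t))ᶜ = Set.range Sum.inr := by
    rw [onSet_thresholdedReadoutIHT, offSet_thresholdedReadoutIHT]
    ext (i | i)
    · simp
    · simp
  rw [hfree] at hK hcard hmax
  replace hcard : K.ncard = min k _ := hcard
  refine ⟨Sum.inr ⁻¹' K, ?_, fun i hi j hj => ?_, ?_⟩
  · rw [Set.ncard_preimage_of_injective_subset_range Sum.inr_injective hK, hcard,
      ← Set.image_univ, Set.ncard_image_of_injective _ Sum.inr_injective, Set.ncard_univ,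
      Nat.card_eq_fintype_card]
  · simpa using hmax _ hi (Sum.inr j) ⟨⟨j, rfl⟩, hj⟩
  · rw [hx, onSet_thresholdedReadoutIHT, offSet_thresholdedReadoutIHT]
    ext j
    by_cases hj : Sum.inr j ∈ K <;> simp [Set.indicator, hj]

/-- The readout layer recovers the support of a sparse vector in finitely many iterations. -/
theorem thresholdedReadoutIHT_recovers {δ : ℝ} (hδ : 0 ≤ δ) (hδ1 : δ ≤ 1 / 5)
    (hD : SatisfiesRIP D (2 * k) δ) (xs : κ → ℝ) (hxs : l0 xs ≤ k) :
    ∃ T : ℕ, ∀ x : ℕ → ι ⊕ κ → ℝ,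
      (thresholdedReadoutIHT D f k (1 + δ)⁻¹).IsRun (D *ᵥ xs) x →
      ∀ t, T ≤ t → ∀ i, x t (Sum.inl i) ≠ 0 ↔ xs (f i) ≠ 0 := by
  -- The factor `2` is a crude bound for `1 / (1 - δ)`, which turns residuals into errors.
  set C := 2 * ((D *ᵥ xs) ⬝ᵥ (D *ᵥ xs)) with hC
  have h1 : ∀ᶠ t : ℕ in atTop, C * (8 / 9) ^ t < 1 := by
    have := (tendsto_pow_atTop_nhds_zero_of_lt_one (r := (8 / 9 : ℝ)) (by norm_num)
      (by norm_num)).const_mul C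
    rw [mul_zero] at this
    exact this.eventually_lt_const one_pos
  -- One `(3/4)^t` absorbs the error, the other is the readout threshold.
  have h2 : ∀ᶠ t : ℕ in atTop, ∀ j : κ, xs j ≠ 0 → 2 * (3 / 4 : ℝ) ^ t < |xs j| := by
    refine eventually_all.2 fun j => ?_
    by_cases hj : xs j = 0
    · simp [hj]
    · have := (tendsto_pow_atTop_nhds_zero_of_lt_one (r := (3 / 4 : ℝ)) (by norm_num)
        (by norm_num)).const_mul 2
      rw [mul_zero] at this
      exact (this.eventually_lt_const (abs_pos.2 hj)).mono fun t ht _ => ht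
  obtain ⟨T, hT⟩ := eventually_atTop.1 (h1.and h2)
  -- The readout lags one step behind the units it copies.
  refine ⟨T + 1, fun x hrun t ht i => ?_⟩
  obtain ⟨t, rfl⟩ : ∃ s, t = s + 1 := ⟨t - 1, by omega⟩
  obtain ⟨hT1, hT2⟩ := hT t (by omega)
  rw [thresholdedReadoutIHT_readout hrun]
  choose K hK hmax hx using thresholdedReadoutIHT_iterate hrun
  simp only [← Matrix.mulVec_sub] at hmax hx
  obtain ⟨hs, hres⟩ := residual_le_geometric (x := fun t => x t ∘ Sum.inr) hδ hδ1 hD hxs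
    (by simp [hrun.1]) K hK hmax hx t
  have hR := (hD (xs - x t ∘ Sum.inr) ((l0_sub_le _ _).trans (by omega))).1
  simp only [euclNorm_sq] at hR
  have hi := sq_apply_le_dotProduct_self (xs - x t ∘ Sum.inr) (f i)
  have herr : |xs (f i) - x t (Sum.inr (f i))| < (3 / 4) ^ t := by
    refine abs_lt_of_sq_lt_sq ?_ (by positivity)
    have hp : (0 : ℝ) < (9 / 16) ^ t := by positivity
    have e1 : ((3 / 4 : ℝ) ^ t) ^ 2 = (9 / 16) ^ t := by
      rw [← pow_mul, mul_comm, pow_mul]; norm_num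
    -- The squared error decays like `(1/2)^t`, the squared threshold like `(9/16)^t`; their ratio
    -- `(8/9)^t` beats `C`.
    have e2 : (1 / 2 : ℝ) ^ t = (8 / 9) ^ t * (9 / 16) ^ t := by
      rw [← mul_pow]; norm_num
    have hnn : 0 ≤ (xs - x t ∘ Sum.inr) ⬝ᵥ (xs - x t ∘ Sum.inr) := (sq_nonneg _).trans hi
    have h3 : (xs (f i) - x t (Sum.inr (f i))) ^ 2 ≤ C * (1 / 2) ^ t := by
      simp only [Pi.sub_apply, Function.comp_apply] at hi
      nlinarith
    rw [e1]
    rw [e2] at h3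
    nlinarith
  constructor
  · intro h h0
    rw [h0, zero_sub, abs_neg] at herr
    exact lt_asymm h herr
  · intro h
    have := hT2 (f i) h
    have := abs_sub_abs_le_abs_sub (xs (f i)) (x t (Sum.inr (f i)))
    linarith

end Readout

/-! ### Lifting the clustered model to `[U, A]` -/

section ClusteredModel

variable {n c : ℕ} {m : Fin c → ℕ}

/-- If the column vanished, then `v u = -ε a` with unit vectors `u`, `a` would force `|v| = ε`. -/
theorem rawDictionary_column_ne_zero {U : Matrix (Fin n) (Fin c) ℝ}
    {A : Matrix (Fin n) (Cols m) ℝ} {v : (j : Fin c) → Fin (m j) → ℝ} (hU : UnitColumns U)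
    (hA : UnitColumns A) {ε : ℝ} (hε : 0 < ε) {p : Cols m} (hp : v p.1 p.2 ≠ 0 → ε < |v p.1 p.2|) :
    (euclNorm fun i => rawDictionary U A v ε i p) ≠ 0 := by
  intro h
  have hz : (fun i => rawDictionary U A v ε i p) = 0 := by
    simpa [euclNorm] using h
  have he : v p.1 p.2 • (fun i => U i p.1) = (-ε) • fun i => A i p := by
    ext i
    have := congrFun hz i
    simp only [rawDictionary, Matrix.of_apply, Pi.zero_apply] at this
    simp only [Pi.smul_apply, smul_eq_mul]
    linarith
  have hn := congrArg euclNorm he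
  rw [euclNorm_smul, euclNorm_smul, hU, hA, abs_neg, abs_of_pos hε, mul_one, mul_one] at hn
  exact (hp (abs_pos.1 (hn ▸ hε))).ne' hn

/-- The coefficients of `Φ(ε) x` with respect to `[U, A]`. -/
noncomputable def liftedCoeffs (U : Matrix (Fin n) (Fin c) ℝ) (A : Matrix (Fin n) (Cols m) ℝ)
    (v : (j : Fin c) → Fin (m j) → ℝ) (ε : ℝ) (x : Cols m → ℝ) :
    Fin c ⊕ {p : Cols m // p.1 ∈ Finset.univ} → ℝ :=
  Sum.elim
    (fun j => ∑ l, v j l * ((euclNorm fun i => rawDictionary U A v ε i ⟨j, l⟩)⁻¹ * x ⟨j, l⟩))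
    fun p => ε * ((euclNorm fun i => rawDictionary U A v ε i p.1)⁻¹ * x p.1)

theorem concatBlocks_mulVec_liftedCoeffs (U : Matrix (Fin n) (Fin c) ℝ)
    (A : Matrix (Fin n) (Cols m) ℝ) (v : (j : Fin c) → Fin (m j) → ℝ) (ε : ℝ) (x : Cols m → ℝ) :
    concatBlocks U A Finset.univ *ᵥ liftedCoeffs U A v ε x =
      clusteredDictionary U A v ε *ᵥ x := by
  ext i
  rw [concatBlocks, liftedCoeffs, Matrix.fromCols_mulVec_sumElim, clusteredDictionary,
    ← Matrix.mulVec_mulVec, show Matrix.diagonal _ *ᵥ x = fun p =>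
      (euclNorm fun i => rawDictionary U A v ε i p)⁻¹ * x p from
        funext (Matrix.mulVec_diagonal _ _)]
  simp only [Pi.add_apply, Matrix.mulVec, dotProduct, Matrix.submatrix_apply, id]
  have h1 := (Equiv.subtypeUnivEquiv (p := fun p : Cols m => p.1 ∈ Finset.univ)
    fun p => Finset.mem_univ p.1).sum_comp fun p =>
      A i p * (ε * ((euclNorm fun i => rawDictionary U A v ε i p)⁻¹ * x p))
  simp only [Equiv.subtypeUnivEquiv_apply] at h1
  rw [h1]
  simp only [Finset.mul_sum]
  rw [← Fintype.sum_sigma' (fun (j : Fin c) (l : Fin (m j)) => U i j *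
    (v j l * ((euclNorm fun i => rawDictionary U A v ε i ⟨j, l⟩)⁻¹ * x ⟨j, l⟩))),
    ← Finset.sum_add_distrib]
  refine Finset.sum_congr rfl fun p _ => ?_
  simp only [rawDictionary, Matrix.of_apply]
  ring

theorem l0_liftedCoeffs_le (U : Matrix (Fin n) (Fin c) ℝ)
    (A : Matrix (Fin n) (Cols m) ℝ) (v : (j : Fin c) → Fin (m j) → ℝ) (ε : ℝ) (x : Cols m → ℝ) :
    l0 (liftedCoeffs U A v ε x) ≤ l0 x + (clusterSupport x).ncard := by
  have hsub : Function.support (liftedCoeffs U A v ε x) ⊆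
      (fun p : Cols m => Sum.inr ⟨p, Finset.mem_univ _⟩) '' Function.support x ∪
        Sum.inl '' clusterSupport x := by
    rintro (j | p) hp
    · refine Or.inr ⟨j, ?_, rfl⟩
      by_contra hj
      have hz : ∀ l, x ⟨j, l⟩ = 0 := fun l => by_contra fun hl => hj ⟨l, hl⟩
      exact hp (by simp [liftedCoeffs, hz])
    · refine Or.inl ⟨p.1, fun h => hp ?_, rfl⟩
      simp [liftedCoeffs, h]
  exact (Set.ncard_le_ncard hsub (Set.toFinite _)).trans ((Set.ncard_union_le _ _).trans
    (add_le_add (Set.ncard_image_le (Set.toFinite _)) (Set.ncard_image_le (Set.toFinite _))))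

/-- This supplies the `kx` in `min kx kc`, without which `2(kx + kc)` could exceed `3kx + kc`. -/
theorem ncard_clusterSupport_le_l0 (x : Cols m → ℝ) : (clusterSupport x).ncard ≤ l0 x := by
  have hsub : clusterSupport x ⊆ Sigma.fst '' Function.support x := by
    rintro j ⟨l, hl⟩
    exact ⟨⟨j, l⟩, hl, rfl⟩
  exact (Set.ncard_le_ncard hsub (Set.toFinite _)).trans (Set.ncard_image_le (Set.toFinite _))

end ClusteredModel

/-! ### Support recovery -/

theorem proposition3 {n c : ℕ} (m : Fin c → ℕ) (kx kc : ℕ)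
    (U : Matrix (Fin n) (Fin c) ℝ) (A : Matrix (Fin n) (Cols m) ℝ)
    (v : (j : Fin c) → Fin (m j) → ℝ)
    (hU : UnitColumns U) (hA : UnitColumns A)
    (hRIP : ∀ J : Finset (Fin c), ripConst (concatBlocks U A J) (3 * kx + kc) < 1 / √32) :
    ∃ (p : ℕ) (S : AIHT n (Cols m ⊕ Fin p)), ∃ ε' : ℝ, 0 < ε' ∧
      ∀ ε : ℝ, 0 < ε → ε ≤ ε' → ∀ xs : Cols m → ℝ,
        l0 xs ≤ kx → (clusterSupport xs).ncard ≤ kc →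
        ∃ T : ℕ, ∀ x : ℕ → (Cols m ⊕ Fin p) → ℝ,
          S.IsRun (clusteredDictionary U A v ε *ᵥ xs) x →
          ∀ t : ℕ, T ≤ t → ∀ i : Cols m, x t (Sum.inl i) ≠ 0 ↔ xs i ≠ 0 := by
  obtain ⟨δ, hδ, hδ1, hD⟩ := exists_satisfiesRIP_of_ripConst_lt (hRIP Finset.univ)
  have hδ5 : δ ≤ 1 / 5 := by
    refine hδ1.le.trans (one_div_le_one_div_of_le (by norm_num) ?_)
    -- Since `25 ≤ 32`, the constant is at most `1/5`, which is what makes the rate `2δ / (1 - δ)`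
    -- at most `1/2`.
    exact Real.le_sqrt_of_sq_le (by norm_num)
  let e := (Fintype.equivFin (Fin c ⊕ {p : Cols m // p.1 ∈ Finset.univ})).symm
  let D := (concatBlocks U A Finset.univ).submatrix id e
  let f : Cols m → Fin _ := fun p => e.symm (Sum.inr ⟨p, Finset.mem_univ _⟩)
  -- Below every nonzero `|v|`, no column cancels. This is the only restriction on `ε`; the scheme
  -- does not depend on it.
  obtain ⟨ε', hε', hv⟩ : ∃ ε' : ℝ, 0 < ε' ∧
      ∀ p : Cols m, v p.1 p.2 ≠ 0 → ε' < |v p.1 p.2| := by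
    have h : ∀ᶠ ε in 𝓝[>] (0 : ℝ), ∀ p : Cols m, v p.1 p.2 ≠ 0 → ε < |v p.1 p.2| := by
      refine eventually_all.2 fun p => ?_
      by_cases hp : v p.1 p.2 = 0
      · simp [hp]
      · exact ((eventually_lt_nhds (abs_pos.2 hp)).filter_mono nhdsWithin_le_nhds).mono
          fun ε h _ => h
    obtain ⟨ε', h1, h2⟩ := (h.and self_mem_nhdsWithin).exists
    exact ⟨ε', h2, h1⟩
  refine ⟨_, thresholdedReadoutIHT D f (kx + min kx kc) (1 + δ)⁻¹, ε', hε', ?_⟩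
  intro ε hε hεε' xs hxs hcs
  have hD' : SatisfiesRIP D (2 * (kx + min kx kc)) δ := (hD.mono (by omega)).submatrix e
  have hlift : l0 (liftedCoeffs U A v ε xs ∘ e) ≤ kx + min kx kc := by
    rw [l0_comp_equiv]
    have := l0_liftedCoeffs_le U A v ε xs
    have := ncard_clusterSupport_le_l0 xs
    omega
  obtain ⟨T, hT⟩ := thresholdedReadoutIHT_recovers (f := f) hδ hδ5 hD' _ hlift
  have hy : D *ᵥ (liftedCoeffs U A v ε xs ∘ e) = clusteredDictionary U A v ε *ᵥ xs := by
    rw [Matrix.submatrix_mulVec_equiv, Function.comp_assoc, Equiv.self_comp_symm,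
      Function.comp_id, Function.comp_id, concatBlocks_mulVec_liftedCoeffs]
  refine ⟨T, fun x hx t ht i => (hT x (by rwa [hy]) t ht i).trans ?_⟩
  -- The lifted `A`-coefficient is `xs i` times `ε` and an inverse column norm, both nonzero, so the
  -- supports agree.
  have hN := rawDictionary_column_ne_zero hU hA hε fun hp => hεε'.trans_lt (hv i hp)
  simp [f, liftedCoeffs, hε.ne', hN]
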